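/- Setting. There are $n\ge 2$ experts; expert $i$ has a finite signal space $\mathcal S_i$ with $|\mathcal S_i|=m\ge 1$. Put $\boldsymbol{\mathcal S}=\mathcal S_1\times\dots\times\mathcal S_n$ and let $\mathcal P_{\mathrm{all}}$ be the set of all probability distributions $P$ of $(\boldsymbol s,\omega)$ on $\boldsymbol{\mathcal S}\times\{0,1\}$. Under $P$, expert $i$ with signal $s_i$ reports $r_i=P(\omega=1\mid s_i)$; write $\boldsymbol r=(r_1,\dots,r_n)$. An aggregator is a function $f:[0,1]^n\to[0,1]$, its loss is $L_P(f)=\mathbb E_P[|f(\boldsymbol r)-\omega|^2]$, and $f^*$ denotes an aggregator that minimizes $L_P$ (unique on the reports of positive probability). An aggregator $f$ is $\varepsilon$-optimal for $P$ if $\mathbb E_P[|f(\boldsymbol r)-f^*(\boldsymbol r)|^2]\le\varepsilon$. The sample complexity $T_{\mathcal P_{\mathrm{all}}}(\varepsilon,\delta)$ is the least $T_0$ such that for every $T\ge T_0$ there is a (possibly randomized) procedure which, for every $P\in\mathcal P_{\mathrm{all}}$, given only $T$ samples $(\boldsymbol r^{(t)},\omega^{(t)})$ obtained from i.i.d. draws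 $(\boldsymbol s^{(t)},\omega^{(t)})\sim P$, outputs an $\varepsilon$-optimal aggregator for $P$ with probability at least $1-\delta$ over the samples and its own randomness. Theorem. There are absolute constants $C,c,\varepsilon_0>0$ such that for all $n\ge 2$, all $m\ge1$, all such signal spaces, and all $\varepsilon,\delta\in(0,1)$, $$T_{\mathcal P_{\mathrm{all}}}(\varepsilon,\delta)\ \le\ C\,\frac{m^n+\log(1/\delta)}{\varepsilon^2},$$ and, if moreover $m\ge 2$, $\varepsilon<\varepsilon_0$ and $\delta<1/100$, $$T_{\mathcal P_{\mathrm{all}}}(\varepsilon,\delta)\ \ge\ c\,\frac{m^{n-2}+\log(1/\delta)}{\varepsilon}.$$ -/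

import Mathlib

open scoped ENNReal

universe u

noncomputable section

namespace ForecastAggregation

/-- A joint distribution of the signals `s = (s 1, …, s n)` and the binary event `ω`
(`true` for `ω = 1`, `false` for `ω = 0`): a probability vector on the finite set
`(S 1 × ⋯ × S n) × {0, 1}`. -/
abbrev JointDist {n : ℕ} (S : Fin n → Type u) [∀ i, Fintype (S i)] : Type u :=
  ↥(stdSimplex ℝ ((∀ i, S i) × Bool))

/-- An aggregator `f : [0,1]^n → [0,1]`. The type carries the product σ-algebra. -/
abbrev Aggregator (n : ℕ) : Type :=
  (Fin n → unitInterval) → unitInterval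

/-- The numerical value (0 or 1) of the event. -/
def eventValue (ω : Bool) : ℝ := if ω then 1 else 0

variable {n : ℕ} {S : Fin n → Type u} [∀ i, Fintype (S i)]

open Classical in
/-- The marginal probability `P(s_i = a, ω)`. -/
def marginal (P : JointDist S) (i : Fin n) (a : S i) (ω : Bool) : ℝ :=
  ∑ s : ∀ i, S i, if s i = a then P.1 (s, ω) else 0

theorem marginal_nonneg (P : JointDist S) (i : Fin n) (a : S i) (ω : Bool) :
    0 ≤ marginal P i a ω := by
  refine Finset.sum_nonneg fun s _ => ?_
  split_ifs
  · exact P.2.1 _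
  · exact le_rfl

/-- The forecast of expert `i` on seeing the signal `a`:
`P(ω = 1 ∣ s_i = a) = P(s_i = a, ω = 1) / (P(s_i = a, ω = 1) + P(s_i = a, ω = 0))`.
It is `0` for a signal of probability zero, which is never observed. -/
def report (P : JointDist S) (i : Fin n) (a : S i) : unitInterval :=
  ⟨marginal P i a true / (marginal P i a true + marginal P i a false),
    unitInterval.div_mem (marginal_nonneg P i a true)
      (add_nonneg (marginal_nonneg P i a true) (marginal_nonneg P i a false))
      (le_add_of_nonneg_right (marginal_nonneg P i a false))⟩

/-- The joint report `r = (r 1, …, r n)` produced by the joint signal `s`. -/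
def reports (P : JointDist S) (s : ∀ i, S i) : Fin n → unitInterval :=
  fun i => report P i (s i)

/-- The mean squared loss `L_P(f) = E_P[|f(r) - ω|²]`. -/
def loss (P : JointDist S) (f : Aggregator n) : ℝ :=
  ∑ x : (∀ i, S i) × Bool, P.1 x * |(f (reports P x.1) : ℝ) - eventValue x.2| ^ 2

/-- `g` is an optimal aggregator for `P`: it minimizes the loss over all aggregators. -/
def IsOptimal (P : JointDist S) (g : Aggregator n) : Prop :=
  ∀ f : Aggregator n, loss P g ≤ loss P f

/-- The mean squared difference `E_P[|f(r) - g(r)|²]`. -/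
def sqDist (P : JointDist S) (f g : Aggregator n) : ℝ :=
  ∑ x : (∀ i, S i) × Bool,
    P.1 x * |(f (reports P x.1) : ℝ) - (g (reports P x.1) : ℝ)| ^ 2

/-- `f` is `ε`-optimal for `P`: `E_P[|f(r) - f*(r)|²] ≤ ε` for the optimal aggregator `f*`.
(Optimal aggregators exist and agree on all reports of positive probability.) -/
def IsEpsOptimal (P : JointDist S) (ε : ℝ) (f : Aggregator n) : Prop :=
  ∃ g : Aggregator n, IsOptimal P g ∧ sqDist P f g ≤ ε

/-- A (possibly randomized) learning procedure using `T` samples: it sees the reports and the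
events `(r^(t), ω^(t))`, `t < T`, and outputs a random aggregator, given by its law. -/
abbrev Learner (n T : ℕ) : Type :=
  (Fin T → (Fin n → unitInterval) × Bool) → MeasureTheory.ProbabilityMeasure (Aggregator n)

/-- The probability, over `T` i.i.d. draws `(s^(t), ω^(t))` from `P` and the randomness of the
learner, that the learner fed with `(r^(t), ω^(t))` outputs an `ε`-optimal aggregator. -/
def successProb (P : JointDist S) (ε : ℝ) {T : ℕ} (A : Learner n T) : ℝ :=
  ∑ x : Fin T → (∀ i, S i) × Bool, (∏ t, P.1 (x t)) *
    (A (fun t => (reports P (x t).1, (x t).2)) : MeasureTheory.Measure (Aggregator n)).real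
      {f | IsEpsOptimal P ε f}

/-- `T` samples suffice for the family `F`: one learner succeeds with probability at least
`1 - δ` on every distribution of the family. -/
def Suffices (F : Set (JointDist S)) (ε δ : ℝ) (T : ℕ) : Prop :=
  ∃ A : Learner n T, ∀ P ∈ F, 1 - δ ≤ successProb P ε A

/-- The sample complexity of forecast aggregation with respect to `F`: the least `T₀` such that
every number `T ≥ T₀` of samples suffices (`⊤` if there is none). -/
def sampleComplexity (F : Set (JointDist S)) (ε δ : ℝ) : ℕ∞ :=
  sInf ((fun T₀ : ℕ => (T₀ : ℕ∞)) '' {T₀ : ℕ | ∀ T : ℕ, T₀ ≤ T → Suffices F ε δ T})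

end ForecastAggregation

end

/-!
Upper bound: the empirical and the true probability of every event agree up to `ε / 2` with high
probability, by Hoeffding's inequality and a union bound over the `2 ^ (2 * m ^ n)` events. Then all
empirical losses are uniformly accurate, so that an empirical risk minimizer is nearly optimal; by
convexity of the squared loss, its excess loss bounds its distance to the optimum.

Lower bound: let the signals be uniform and let `P(ω = 1 ∣ s)` be a base value moved up or down by
`γ ~ √ε`. The direction is the parity of two binary signals and a hidden bit, one such bit for each
joint signal of the other `n - 2` experts. Given a single signal the direction is still a fair coin,
so the reports do not depend on the hidden bits; slight shifts of the base value make them reveal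
the signals, and an `ε`-optimal aggregator has to recover most of the bits. Comparing distributions
that differ in one bit gives the term `m ^ (n - 2)` by Assouad's lemma, and comparing two opposite
choices of all the bits gives the term `log (1 / δ)` by Le Cam's two-point method. Restricting the
two experts to two signals each covers larger alphabets.
-/

namespace ForecastAggregation

noncomputable section

section FiniteProbability

variable {X Y : Type*} [Fintype X] [Fintype Y]

/-- The expectation of `g` under the probability vector `p`. -/
def mean (p : stdSimplex ℝ X) (g : X → ℝ) : ℝ := ∑ x, p.1 x * g x

/-- The probability of the event `E` under the probability vector `p`. -/
def prob (p : stdSimplex ℝ X) (E : Set X) : ℝ := mean p (E.indicator 1)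

/-- The law of `T` independent draws from `p`. -/
def iid (p : stdSimplex ℝ X) (T : ℕ) : stdSimplex ℝ (Fin T → X) :=
  ⟨fun x => ∏ t, p.1 (x t), fun x => Finset.prod_nonneg fun t _ => p.2.1 (x t), by
    rw [← Fintype.sum_pow, p.2.2, one_pow]⟩

theorem mean_const (p : stdSimplex ℝ X) (a : ℝ) : mean p (fun _ => a) = a := by
  rw [mean, ← Finset.sum_mul, p.2.2, one_mul]

theorem mean_mono (p : stdSimplex ℝ X) {f g : X → ℝ} (h : ∀ x, f x ≤ g x) :
    mean p f ≤ mean p g :=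
  Finset.sum_le_sum fun x _ => mul_le_mul_of_nonneg_left (h x) (p.2.1 x)

theorem mean_nonneg (p : stdSimplex ℝ X) {g : X → ℝ} (h : ∀ x, 0 ≤ g x) : 0 ≤ mean p g :=
  Finset.sum_nonneg fun x _ => mul_nonneg (p.2.1 x) (h x)

theorem mean_sub (p : stdSimplex ℝ X) (f g : X → ℝ) :
    mean p (fun x => f x - g x) = mean p f - mean p g := by
  simp only [mean, mul_sub, Finset.sum_sub_distrib]

theorem mean_const_mul (p : stdSimplex ℝ X) (a : ℝ) (g : X → ℝ) :
    mean p (fun x => a * g x) = a * mean p g := by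
  simp only [mean, Finset.mul_sum, mul_left_comm]

theorem mean_sum {ι : Type*} (p : stdSimplex ℝ X) (s : Finset ι) (g : ι → X → ℝ) :
    mean p (fun x => ∑ i ∈ s, g i x) = ∑ i ∈ s, mean p (g i) := by
  simp only [mean, Finset.mul_sum]
  exact Finset.sum_comm

theorem mean_iid_prod (p : stdSimplex ℝ X) (T : ℕ) (g : X → ℝ) :
    mean (iid p T) (fun x => ∏ t, g (x t)) = mean p g ^ T := by
  simp only [mean, iid, ← Finset.prod_mul_distrib, Fintype.sum_pow]

theorem prob_mono (p : stdSimplex ℝ X) {E F : Set X} (h : E ⊆ F) : prob p E ≤ prob p F :=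
  mean_mono p (Set.indicator_le_indicator_of_subset h fun _ => zero_le_one)

theorem prob_compl (p : stdSimplex ℝ X) (E : Set X) : prob p Eᶜ = 1 - prob p E := by
  rw [prob, prob, Set.indicator_compl, ← mean_const p 1]
  exact mean_sub p _ _

theorem prob_le_one (p : stdSimplex ℝ X) (E : Set X) : prob p E ≤ 1 :=
  (mean_mono p (Set.indicator_le_self' fun _ _ => zero_le_one)).trans_eq (mean_const p 1)

theorem prob_iUnion_le {ι : Type*} [Fintype ι] (p : stdSimplex ℝ X) (E : ι → Set X) :
    prob p (⋃ i, E i) ≤ ∑ i, prob p (E i) := by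
  have h_nonneg (x : X) (i : ι) : 0 ≤ (E i).indicator (1 : X → ℝ) x :=
    Set.indicator_nonneg (fun _ _ => zero_le_one) x
  simp only [prob, ← mean_sum]
  refine mean_mono p fun x => Set.indicator_apply_le' (fun hx => ?_)
    fun _ => Finset.sum_nonneg fun i _ => h_nonneg x i
  obtain ⟨i, hi⟩ := Set.mem_iUnion.1 hx
  rw [← Set.indicator_of_mem hi (1 : X → ℝ)]
  exact Finset.single_le_sum (fun i _ => h_nonneg x i) (Finset.mem_univ i)

theorem mean_exp_mul_le (p : stdSimplex ℝ X) {h : X → ℝ} (h_le : ∀ x, |h x| ≤ 1)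
    (h_mean : mean p h = 0) (s : ℝ) : mean p (fun x => Real.exp (s * h x)) ≤ Real.exp (s ^ 2 / 2) :=
  calc mean p (fun x => Real.exp (s * h x))
      ≤ mean p (fun x => Real.cosh s + h x * Real.sinh s) :=
        mean_mono p fun x => by
          rw [mul_comm]; exact Real.exp_mul_le_cosh_add_mul_sinh (h_le x) s
    _ = Real.cosh s + mean p h * Real.sinh s := by
        simp only [mean, mul_add, Finset.sum_add_distrib, ← Finset.sum_mul, ← mul_assoc, p.2.2,
          one_mul]
    _ ≤ Real.exp (s ^ 2 / 2) := by
        rw [h_mean, zero_mul, add_zero]; exact Real.cosh_le_exp_half_sq s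

theorem prob_iid_le_sum_le_exp (p : stdSimplex ℝ X) {h : X → ℝ} (h_le : ∀ x, |h x| ≤ 1)
    (h_mean : mean p h = 0) (T : ℕ) {η : ℝ} (hη : 0 ≤ η) :
    prob (iid p T) {x | T * η ≤ ∑ t, h (x t)} ≤ Real.exp (-(T * η ^ 2 / 2)) := by
  have markov (x : Fin T → X) : {x : Fin T → X | T * η ≤ ∑ t, h (x t)}.indicator 1 x ≤
      Real.exp (-(T * η ^ 2)) * ∏ t, Real.exp (η * h (x t)) := by
    rw [← Real.exp_sum, ← Real.exp_add, ← Finset.mul_sum]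
    refine Set.indicator_apply_le' (fun hx => Real.one_le_exp ?_) fun _ => (Real.exp_pos _).le
    linarith [mul_le_mul_of_nonneg_left hx.out hη]
  calc prob (iid p T) {x | T * η ≤ ∑ t, h (x t)}
      ≤ mean (iid p T) fun x => Real.exp (-(T * η ^ 2)) * ∏ t, Real.exp (η * h (x t)) :=
        mean_mono _ markov
    _ = Real.exp (-(T * η ^ 2)) * mean p (fun x => Real.exp (η * h x)) ^ T := by
        rw [mean_const_mul, ← mean_iid_prod]
    _ ≤ Real.exp (-(T * η ^ 2)) * Real.exp (η ^ 2 / 2) ^ T := by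
        gcongr
        · exact mean_nonneg p fun x => (Real.exp_pos _).le
        · exact mean_exp_mul_le p h_le h_mean η
    _ = Real.exp (-(T * η ^ 2 / 2)) := by
        rw [← Real.exp_nat_mul, ← Real.exp_add]; ring_nf

theorem sum_mul_le_of_sum_eq_zero {d g : X → ℝ} {c : ℝ} (h_zero : ∑ x, d x = 0)
    (h_le : ∀ A : Finset X, ∑ x ∈ A, d x ≤ c) (hg : ∀ x, |g x| ≤ 1) :
    ∑ x, d x * g x ≤ 2 * c :=
  calc ∑ x, d x * g x
      ≤ ∑ x, (2 * (if 0 ≤ d x then d x else 0) - d x) := by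
        refine Finset.sum_le_sum fun x _ => ?_
        have := abs_le.1 (hg x)
        split_ifs <;> nlinarith
    _ = 2 * ∑ x with 0 ≤ d x, d x := by
        rw [Finset.sum_sub_distrib, h_zero, sub_zero, ← Finset.mul_sum, Finset.sum_filter]
    _ ≤ 2 * c := by gcongr; exact h_le _

theorem sum_sub_card_mul (p : stdSimplex ℝ X) [DecidableEq X] {T : ℕ} (x : Fin T → X)
    (g : X → ℝ) :
    ∑ y, (T * p.1 y - (Finset.univ.filter fun t => x t = y).card) * g y =
      T * mean p g - ∑ t, g (x t) := by
  rw [← Finset.sum_fiberwise' Finset.univ x g]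
  simp only [sub_mul, Finset.sum_sub_distrib, mean, Finset.mul_sum, mul_assoc, Finset.sum_const,
    nsmul_eq_mul]

/-- The samples `x` on which no test function bounded by `1` has an empirical mean more than `2 * η`
below its true mean. -/
def representative (p : stdSimplex ℝ X) (T : ℕ) (η : ℝ) : Set (Fin T → X) :=
  {x | ∀ g : X → ℝ, (∀ y, |g y| ≤ 1) → T * mean p g - ∑ t, g (x t) ≤ 2 * (T * η)}

theorem le_prob_representative (p : stdSimplex ℝ X) (T : ℕ) {η : ℝ} (hη : 0 ≤ η) :
    1 - 2 ^ Fintype.card X * Real.exp (-(T * η ^ 2 / 2)) ≤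
      prob (iid p T) (representative p T η) := by
  classical
  let h (A : Finset X) (y : X) : ℝ := prob p A - (A : Set X).indicator 1 y
  let bad (A : Finset X) : Set (Fin T → X) := {x | T * η ≤ ∑ t, h A (x t)}
  have h_abs (A : Finset X) (y : X) : |h A y| ≤ 1 := by
    have h_ind (x : X) : 0 ≤ (A : Set X).indicator (1 : X → ℝ) x :=
      Set.indicator_nonneg (fun _ _ => zero_le_one) x
    exact Real.dist_le_of_mem_Icc_01 ⟨mean_nonneg p h_ind, prob_le_one p A⟩
      ⟨h_ind y, Set.indicator_le_self' (fun _ _ => zero_le_one) y⟩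
  have h_mean (A : Finset X) : mean p (h A) = 0 := by
    simp only [h, mean_sub, mean_const, prob, sub_self]
  have h_bad : prob (iid p T) (⋃ A, bad A) ≤ 2 ^ Fintype.card X * Real.exp (-(T * η ^ 2 / 2)) :=
    calc prob (iid p T) (⋃ A, bad A) ≤ ∑ A, prob (iid p T) (bad A) := prob_iUnion_le _ _
      _ ≤ ∑ _A : Finset X, Real.exp (-(T * η ^ 2 / 2)) :=
        Finset.sum_le_sum fun A _ => prob_iid_le_sum_le_exp p (h_abs A) (h_mean A) T hη
      _ = 2 ^ Fintype.card X * Real.exp (-(T * η ^ 2 / 2)) := by simp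
  have h_good : (⋃ A, bad A)ᶜ ⊆ representative p T η := by
    intro x hx g hg
    simp only [bad, Set.mem_compl_iff, Set.mem_iUnion, Set.mem_ofPred_eq, not_exists, not_le] at hx
    rw [← sum_sub_card_mul]
    refine sum_mul_le_of_sum_eq_zero ?_ (fun A => ?_) hg
    · simpa [mean_const] using sum_sub_card_mul p x fun _ => 1
    · calc ∑ y ∈ A, (T * p.1 y - (Finset.univ.filter fun t => x t = y).card)
          = ∑ y, (T * p.1 y - (Finset.univ.filter fun t => x t = y).card) *
              (A : Set X).indicator 1 y := by
            simp [Set.indicator_apply, Finset.sum_ite_mem]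
        _ = ∑ t, h A (x t) := (sum_sub_card_mul p x _).trans (by simp [h, prob])
        _ ≤ T * η := (hx A).le
  linarith [prob_mono (iid p T) h_good, prob_compl (iid p T) (⋃ A, bad A)]

theorem map_apply [DecidableEq Y] (f : X → Y) (p : stdSimplex ℝ X) (y : Y) :
    (stdSimplex.map f p).1 y = ∑ x with f x = y, p.1 x :=
  FunOnFinite.linearMap_apply_apply ..

theorem mean_map (f : X → Y) (p : stdSimplex ℝ X) (g : Y → ℝ) :
    mean (stdSimplex.map f p) g = mean p (g ∘ f) := by
  classical
  simp only [mean, map_apply, Finset.sum_mul]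
  rw [← Finset.sum_fiberwise Finset.univ f]
  refine Finset.sum_congr rfl fun y _ => Finset.sum_congr rfl fun x hx => ?_
  rw [← (Finset.mem_filter.1 hx).2, Function.comp_apply]

theorem iid_map (f : X → Y) (p : stdSimplex ℝ X) (T : ℕ) :
    iid (stdSimplex.map f p) T = stdSimplex.map (f ∘ ·) (iid p T) := by
  classical
  refine Subtype.ext <| funext fun y => ?_
  simp only [map_apply, iid, Finset.prod_univ_sum]
  refine Finset.sum_congr ?_ fun _ _ => rfl
  ext x
  simp [funext_iff]

end FiniteProbability

section UpperBound

variable {n : ℕ} {S : Fin n → Type u} [∀ i, Fintype (S i)]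

theorem exists_forall_sum_mul_sq_le {ι : Type*} [Fintype ι] (w : ι → ℝ)
    (r : ι → Fin n → unitInterval) (v : ι → ℝ) :
    ∃ g : Aggregator n, ∀ f : Aggregator n,
      ∑ i, w i * |(g (r i) : ℝ) - v i| ^ 2 ≤ ∑ i, w i * |(f (r i) : ℝ) - v i| ^ 2 := by
  have h_cont : Continuous fun f : Aggregator n => ∑ i, w i * |(f (r i) : ℝ) - v i| ^ 2 := by
    fun_prop
  obtain ⟨g, -, hg⟩ := isCompact_univ.exists_isMinOn Set.univ_nonempty h_cont.continuousOn
  exact ⟨g, fun f => hg (Set.mem_univ f)⟩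

theorem exists_isOptimal (P : JointDist S) : ∃ g : Aggregator n, IsOptimal P g :=
  exists_forall_sum_mul_sq_le P.1 (fun x => reports P x.1) fun x => eventValue x.2

theorem IsOptimal.loss_le_segment {P : JointDist S} {g : Aggregator n} (hg : IsOptimal P g)
    (f : Aggregator n) {t : ℝ} (ht : t ∈ Set.Icc (0 : ℝ) 1) :
    loss P g ≤ (1 - t) * loss P g + t * loss P f - t * (1 - t) * sqDist P f g := by
  let h : Aggregator n := fun r => ⟨(1 - t) * g r + t * f r,
    convex_Icc (0 : ℝ) 1 (g r).2 (f r).2 (sub_nonneg.2 ht.2) ht.1 (sub_add_cancel 1 t)⟩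
  refine (hg h).trans_eq ?_
  simp only [loss, sqDist, Finset.mul_sum, ← Finset.sum_add_distrib, ← Finset.sum_sub_distrib,
    sq_abs, h]
  exact Finset.sum_congr rfl fun x _ => by ring

theorem IsOptimal.sqDist_le {P : JointDist S} {g : Aggregator n} (hg : IsOptimal P g)
    (f : Aggregator n) : sqDist P f g ≤ loss P f - loss P g := by
  have h_lim : Filter.Tendsto (fun t : ℝ => (1 - t) * sqDist P f g) (nhdsWithin 0 (Set.Ioi 0))
      (nhds (sqDist P f g)) := by
    refine tendsto_nhdsWithin_of_tendsto_nhds <| Continuous.tendsto' (by fun_prop) _ _ (by simp)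
  refine le_of_tendsto h_lim ?_
  filter_upwards [Ioc_mem_nhdsGT zero_lt_one] with t ht
  refine le_of_mul_le_mul_left ?_ ht.1
  linarith [hg.loss_le_segment f (Set.Ioc_subset_Icc_self ht)]

theorem abs_sub_eventValue_sq_mem (a : unitInterval) (ω : Bool) :
    |(a : ℝ) - eventValue ω| ^ 2 ∈ Set.Icc (0 : ℝ) 1 := by
  have h_event : eventValue ω ∈ Set.Icc (0 : ℝ) 1 := by cases ω <;> simp [eventValue]
  exact ⟨by positivity, pow_le_one₀ (abs_nonneg _) (Real.dist_le_of_mem_Icc_01 a.2 h_event)⟩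

theorem exists_empirical_risk_minimizer {T : ℕ} (x : Fin T → (Fin n → unitInterval) × Bool) :
    ∃ g : Aggregator n, ∀ f : Aggregator n,
      ∑ t, |(g (x t).1 : ℝ) - eventValue (x t).2| ^ 2 ≤
        ∑ t, |(f (x t).1 : ℝ) - eventValue (x t).2| ^ 2 := by
  simpa using exists_forall_sum_mul_sq_le 1 (fun t => (x t).1) fun t => eventValue (x t).2

/-- An aggregator of least empirical loss on the samples `x`. -/
def erm {T : ℕ} (x : Fin T → (Fin n → unitInterval) × Bool) : Aggregator n :=
  (exists_empirical_risk_minimizer x).choose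

theorem sum_sq_erm_le {T : ℕ} (x : Fin T → (Fin n → unitInterval) × Bool) (f : Aggregator n) :
    ∑ t, |(erm x (x t).1 : ℝ) - eventValue (x t).2| ^ 2 ≤
      ∑ t, |(f (x t).1 : ℝ) - eventValue (x t).2| ^ 2 :=
  (exists_empirical_risk_minimizer x).choose_spec f

theorem isEpsOptimal_erm (P : JointDist S) {ε : ℝ} {T : ℕ} (hT : 0 < T)
    {x : Fin T → (∀ i, S i) × Bool} (hx : x ∈ representative P T (ε / 2)) :
    IsEpsOptimal P ε (erm fun t => (reports P (x t).1, (x t).2)) := by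
  obtain ⟨g, hg⟩ := exists_isOptimal P
  set f := erm fun t => (reports P (x t).1, (x t).2)
  refine ⟨g, hg, (hg.sqDist_le f).trans ?_⟩
  let err (h : Aggregator n) (y : (∀ i, S i) × Bool) : ℝ :=
    |(h (reports P y.1) : ℝ) - eventValue y.2| ^ 2
  have h_dev :
      T * (loss P f - loss P g) - ∑ t, (err f (x t) - err g (x t)) ≤ 2 * (T * (ε / 2)) := by
    have := hx (fun y => err f y - err g y) fun y => Real.dist_le_of_mem_Icc_01
      (abs_sub_eventValue_sq_mem _ _) (abs_sub_eventValue_sq_mem _ _)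
    rwa [mean_sub] at this
  have h_erm : ∑ t, (err f (x t) - err g (x t)) ≤ 0 := by
    rw [Finset.sum_sub_distrib, sub_nonpos]
    exact sum_sq_erm_le (fun t => (reports P (x t).1, (x t).2)) g
  have hT' : (0 : ℝ) < T := Nat.cast_pos.2 hT
  refine le_of_mul_le_mul_left ?_ hT'
  linarith

/-- The deterministic learner that outputs an empirical risk minimizer. -/
def ermLearner (n T : ℕ) : Learner n T := fun x => MeasureTheory.diracProba (erm x)

theorem le_successProb_ermLearner (P : JointDist S) {ε : ℝ} (hε : 0 ≤ ε) {T : ℕ} (hT : 0 < T) :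
    1 - 2 ^ Fintype.card ((∀ i, S i) × Bool) * Real.exp (-(T * ε ^ 2 / 8)) ≤
      successProb P ε (ermLearner n T) :=
  calc 1 - 2 ^ Fintype.card ((∀ i, S i) × Bool) * Real.exp (-(T * ε ^ 2 / 8))
      = 1 - 2 ^ Fintype.card ((∀ i, S i) × Bool) * Real.exp (-(T * (ε / 2) ^ 2 / 2)) := by
        ring_nf
    _ ≤ prob (iid P T) (representative P T (ε / 2)) :=
        le_prob_representative P T (by positivity)
    _ ≤ successProb P ε (ermLearner n T) := by
        refine mean_mono _ fun x => Set.indicator_apply_le' (fun hx => ?_)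
          fun _ => MeasureTheory.measureReal_nonneg
        have h_dirac := MeasureTheory.diracProba_toMeasure_apply_of_mem
          (A := {f | IsEpsOptimal P ε f}) (isEpsOptimal_erm P hT hx)
        exact (congrArg ENNReal.toReal h_dirac).ge

theorem suffices_of_le (F : Set (JointDist S)) {ε δ : ℝ} (hε : 0 < ε) (hδ : 0 < δ) (hδ1 : δ ≤ 1)
    {T : ℕ} (hT : 0 < T)
    (h_le : 16 * ((∏ i, (Fintype.card (S i) : ℝ) + Real.log (1 / δ)) / ε ^ 2) ≤ T) :
    Suffices F ε δ T := by
  refine ⟨ermLearner n T, fun P _ => le_trans ?_ (le_successProb_ermLearner P hε.le hT)⟩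
  have h_card : (Fintype.card ((∀ i, S i) × Bool) : ℝ) = 2 * ∏ i, (Fintype.card (S i) : ℝ) := by
    simp [Fintype.card_pi, mul_comm]
  have h_exponent : 2 * (∏ i, (Fintype.card (S i) : ℝ) + Real.log (1 / δ)) ≤ T * ε ^ 2 / 8 := by
    rw [← mul_div_assoc, div_le_iff₀ (by positivity)] at h_le
    linarith
  have h_log : 0 ≤ Real.log (1 / δ) := Real.log_nonneg (one_le_one_div hδ hδ1)
  have h_two : (2 : ℝ) ≤ Real.exp 1 := by linarith [Real.add_one_le_exp 1]
  have h_fail : 2 ^ Fintype.card ((∀ i, S i) × Bool) * Real.exp (-(T * ε ^ 2 / 8)) ≤ δ :=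
    calc 2 ^ Fintype.card ((∀ i, S i) × Bool) * Real.exp (-(T * ε ^ 2 / 8))
        ≤ Real.exp 1 ^ Fintype.card ((∀ i, S i) × Bool) * Real.exp (-(T * ε ^ 2 / 8)) := by
          gcongr
      _ = Real.exp (2 * ∏ i, (Fintype.card (S i) : ℝ) - T * ε ^ 2 / 8) := by
          rw [← Real.exp_nat_mul, ← Real.exp_add, h_card, mul_one, sub_eq_add_neg]
      _ ≤ Real.exp (-Real.log (1 / δ)) := Real.exp_le_exp.2 (by linarith)
      _ = δ := by rw [one_div, Real.log_inv, neg_neg, Real.exp_log hδ]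
  linarith

theorem sampleComplexity_le [∀ i, Nonempty (S i)] (F : Set (JointDist S)) {ε δ : ℝ} (hε : 0 < ε)
    (hε1 : ε ≤ 1) (hδ : 0 < δ) (hδ1 : δ ≤ 1) :
    ((sampleComplexity F ε δ : ℕ∞) : ℝ≥0∞) ≤
      ENNReal.ofReal (17 * ((∏ i, (Fintype.card (S i) : ℝ) + Real.log (1 / δ)) / ε ^ 2)) := by
  set B : ℝ := (∏ i, (Fintype.card (S i) : ℝ) + Real.log (1 / δ)) / ε ^ 2
  have h_one_le : 1 ≤ B := by
    have h_log : 0 ≤ Real.log (1 / δ) := Real.log_nonneg (one_le_one_div hδ hδ1)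
    have h_prod : (1 : ℝ) ≤ ∏ i, (Fintype.card (S i) : ℝ) := by
      exact_mod_cast Finset.one_le_prod' fun i _ => Fintype.card_pos (α := S i)
    rw [one_le_div (by positivity)]
    linarith [pow_le_one₀ (n := 2) hε.le hε1]
  have h_ceil : sampleComplexity F ε δ ≤ (⌈16 * B⌉₊ : ℕ∞) := by
    refine sInf_le ⟨_, fun T hT => ?_, rfl⟩
    exact suffices_of_le F hε hδ hδ1 ((Nat.ceil_pos.2 (by linarith)).trans_le hT) (Nat.ceil_le.1 hT)
  calc ((sampleComplexity F ε δ : ℕ∞) : ℝ≥0∞) ≤ (⌈16 * B⌉₊ : ℕ∞) := ENat.toENNReal_le.2 h_ceil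
    _ = ENNReal.ofReal ⌈16 * B⌉₊ := by simp
    _ ≤ ENNReal.ofReal (17 * B) :=
        ENNReal.ofReal_le_ofReal (by linarith [Nat.ceil_lt_add_one (a := 16 * B) (by linarith)])

end UpperBound

section Testing

variable {X : Type*} [Fintype X]

/-- The Bhattacharyya coefficient of `p` and `q`; it is close to `1` when they are hard to tell
apart. -/
def affinity (p q : stdSimplex ℝ X) : ℝ := ∑ x, √(p.1 x * q.1 x)

theorem affinity_iid (p q : stdSimplex ℝ X) (T : ℕ) :
    affinity (iid p T) (iid q T) = affinity p q ^ T := by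
  rw [affinity, affinity, Fintype.sum_pow]
  refine Finset.sum_congr rfl fun x _ => ?_
  rw [iid, iid, ← Finset.prod_mul_distrib,
    Real.sqrt_prod _ fun t _ => mul_nonneg (p.2.1 (x t)) (q.2.1 (x t))]

theorem one_sub_le_affinity_iid_sq (p q : stdSimplex ℝ X) {a : ℝ} (ha : a ≤ 1)
    (h_aff : 1 - a ≤ affinity p q) (T : ℕ) :
    1 - 2 * T * a ≤ affinity (iid p T) (iid q T) ^ 2 :=
  calc 1 - 2 * T * a = 1 + (T * 2 : ℕ) * -a := by push_cast; ring
    _ ≤ (1 + -a) ^ (T * 2) := one_add_mul_le_pow (by linarith) _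
    _ ≤ affinity p q ^ (T * 2) := pow_le_pow_left₀ (by linarith) (by linarith) _
    _ = affinity (iid p T) (iid q T) ^ 2 := by rw [affinity_iid, pow_mul]

theorem exp_neg_two_mul_le {a : ℝ} (ha : a ∈ Set.Icc (0 : ℝ) (1 / 2)) :
    Real.exp (-(2 * a)) ≤ 1 - a := by
  rw [Real.exp_neg, inv_le_comm₀ (Real.exp_pos _) (by linarith [ha.2])]
  refine le_trans ?_ (Real.add_one_le_exp (2 * a))
  rw [inv_le_iff_one_le_mul₀ (by linarith [ha.2])]
  nlinarith [mul_nonneg ha.1 (sub_nonneg.2 ha.2)]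

theorem exp_le_affinity_iid_sq (p q : stdSimplex ℝ X) {a : ℝ} (ha : a ∈ Set.Icc (0 : ℝ) (1 / 2))
    (h_aff : 1 - a ≤ affinity p q) (T : ℕ) :
    Real.exp (-(4 * T * a)) ≤ affinity (iid p T) (iid q T) ^ 2 :=
  calc Real.exp (-(4 * T * a)) = Real.exp (-(2 * a)) ^ (T * 2) := by
        rw [← Real.exp_nat_mul]; push_cast; ring_nf
    _ ≤ affinity p q ^ (T * 2) :=
        pow_le_pow_left₀ (Real.exp_pos _).le ((exp_neg_two_mul_le ha).trans h_aff) _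
    _ = affinity (iid p T) (iid q T) ^ 2 := by rw [affinity_iid, pow_mul]

theorem affinity_sq_le_sum_min (p q : stdSimplex ℝ X) :
    affinity p q ^ 2 ≤ 2 * ∑ x, min (p.1 x) (q.1 x) := by
  have h_min (x : X) : 0 ≤ min (p.1 x) (q.1 x) := le_min (p.2.1 x) (q.2.1 x)
  have h_max (x : X) : 0 ≤ max (p.1 x) (q.1 x) := (p.2.1 x).trans (le_max_left _ _)
  have h_sum_max : ∑ x, max (p.1 x) (q.1 x) ≤ 2 :=
    calc ∑ x, max (p.1 x) (q.1 x) ≤ ∑ x, (p.1 x + q.1 x) :=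
          Finset.sum_le_sum fun x _ => max_le_add_of_nonneg (p.2.1 x) (q.2.1 x)
      _ = 2 := by rw [Finset.sum_add_distrib, p.2.2, q.2.2, one_add_one_eq_two]
  calc affinity p q ^ 2
      = (∑ x, √(min (p.1 x) (q.1 x)) * √(max (p.1 x) (q.1 x))) ^ 2 := by
        simp only [affinity, ← Real.sqrt_mul (h_min _), min_mul_max]
    _ ≤ (∑ x, √(min (p.1 x) (q.1 x)) ^ 2) * ∑ x, √(max (p.1 x) (q.1 x)) ^ 2 :=
        Finset.sum_mul_sq_le_sq_mul_sq _ _ _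
    _ = (∑ x, min (p.1 x) (q.1 x)) * ∑ x, max (p.1 x) (q.1 x) := by
        simp only [Real.sq_sqrt (h_min _), Real.sq_sqrt (h_max _)]
    _ ≤ 2 * ∑ x, min (p.1 x) (q.1 x) := by
        rw [mul_comm]; gcongr; exact Finset.sum_nonneg fun x _ => h_min x

theorem sum_min_le_mean_add_mean (p q : stdSimplex ℝ X) {α : X → ℝ}
    (hα : ∀ x, α x ∈ Set.Icc (0 : ℝ) 1) :
    ∑ x, min (p.1 x) (q.1 x) ≤ mean p α + mean q fun x => 1 - α x := by
  rw [mean, mean, ← Finset.sum_add_distrib]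
  refine Finset.sum_le_sum fun x _ => ?_
  calc min (p.1 x) (q.1 x) = min (p.1 x) (q.1 x) * α x + min (p.1 x) (q.1 x) * (1 - α x) := by
        ring
    _ ≤ p.1 x * α x + q.1 x * (1 - α x) := by
        gcongr
        · exact (hα x).1
        · exact min_le_left _ _
        · exact sub_nonneg.2 (hα x).2
        · exact min_le_right _ _

theorem affinity_sq_le_mean_add_mean (p q : stdSimplex ℝ X) {α : X → ℝ}
    (hα : ∀ x, α x ∈ Set.Icc (0 : ℝ) 1) :
    affinity p q ^ 2 ≤ 2 * (mean p α + mean q fun x => 1 - α x) :=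
  (affinity_sq_le_sum_min p q).trans <|
    mul_le_mul_of_nonneg_left (sum_min_le_mean_add_mean p q hα) zero_le_two

/-- The involution of the Boolean cube that flips the coordinate `c`. -/
def flipAt {C : Type*} [DecidableEq C] (c : C) : Equiv.Perm (C → Bool) :=
  Function.Involutive.toPerm (fun τ => Function.update τ c (!τ c)) fun τ => by simp

theorem flipAt_apply {C : Type*} [DecidableEq C] (c c' : C) (τ : C → Bool) :
    flipAt c τ c' = if c' = c then !τ c else τ c' :=
  Function.update_apply ..

/-- Here `err · j` is the error of a test of the coordinate `κ j` of the Boolean cube. -/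
theorem assouad {C ι : Type*} [Finite C] [DecidableEq C] [Fintype ι] (κ : ι → C)
    (p : (C → Bool) → stdSimplex ℝ X) {err : (C → Bool) → ι → X → ℝ} {a b : ℝ}
    (h_mem : ∀ τ j x, err τ j x ∈ Set.Icc (0 : ℝ) 1)
    (h_flip : ∀ τ j x, err (flipAt (κ j) τ) j x = 1 - err τ j x)
    (h_aff : ∀ τ c, 1 - a ≤ affinity (p τ) (p (flipAt c τ)) ^ 2)
    (h_le : ∀ τ, ∑ j, mean (p τ) (err τ j) ≤ b) :
    Fintype.card ι * (1 - a) ≤ 4 * b := by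
  have := Fintype.ofFinite C
  have h_two_point (j : ι) (τ : C → Bool) : 1 - a ≤
      2 * (mean (p τ) (err τ j) + mean (p (flipAt (κ j) τ)) (err (flipAt (κ j) τ) j)) := by
    rw [funext (h_flip τ j)]
    exact (h_aff τ (κ j)).trans (affinity_sq_le_mean_add_mean _ _ (h_mem τ j))
  have h_test (j : ι) : Fintype.card (C → Bool) * (1 - a) ≤ 4 * ∑ τ, mean (p τ) (err τ j) :=
    calc Fintype.card (C → Bool) * (1 - a)
        = ∑ _τ : C → Bool, (1 - a) := by
          rw [Finset.sum_const, Finset.card_univ, nsmul_eq_mul]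
      _ ≤ ∑ τ, 2 * (mean (p τ) (err τ j) +
            mean (p (flipAt (κ j) τ)) (err (flipAt (κ j) τ) j)) :=
          Finset.sum_le_sum fun τ _ => h_two_point j τ
      _ = 4 * ∑ τ, mean (p τ) (err τ j) := by
          rw [← Finset.mul_sum, Finset.sum_add_distrib,
            Equiv.sum_comp (flipAt (κ j)) fun τ => mean (p τ) (err τ j)]
          ring
  refine le_of_mul_le_mul_left ?_ (Nat.cast_pos.2 Fintype.card_pos :
    (0 : ℝ) < Fintype.card (C → Bool))
  calc Fintype.card (C → Bool) * (Fintype.card ι * (1 - a))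
      = ∑ _j : ι, Fintype.card (C → Bool) * (1 - a) := by
        rw [Finset.sum_const, Finset.card_univ, nsmul_eq_mul]; ring
    _ ≤ ∑ j, 4 * ∑ τ, mean (p τ) (err τ j) := Finset.sum_le_sum fun j _ => h_test j
    _ = 4 * ∑ τ, ∑ j, mean (p τ) (err τ j) := by rw [← Finset.mul_sum, Finset.sum_comm]
    _ ≤ 4 * ∑ _τ : C → Bool, b := by gcongr with τ; exact h_le τ
    _ = Fintype.card (C → Bool) * (4 * b) := by
        rw [Finset.sum_const, Finset.card_univ, nsmul_eq_mul]; ring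

theorem measurableSet_sum_indicator_le {Ω ι : Type*} [MeasurableSpace Ω] [Fintype ι]
    {W : ι → Set Ω} (hW : ∀ j, MeasurableSet (W j)) (k : ℝ) :
    MeasurableSet {f | ∑ j, (W j).indicator 1 f ≤ k} :=
  measurableSet_le (Finset.measurable_sum _ fun j _ => measurable_const.indicator (hW j))
    measurable_const

theorem sum_measureReal_le {Ω ι : Type*} [MeasurableSpace Ω] (μ : MeasureTheory.Measure Ω)
    [MeasureTheory.IsProbabilityMeasure μ] [Fintype ι] {W : ι → Set Ω}
    (hW : ∀ j, MeasurableSet (W j)) {k : ℝ} (hk : 0 ≤ k) :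
    ∑ j, μ.real (W j) ≤ k + Fintype.card ι *
      (1 - μ.real {f | ∑ j, (W j).indicator 1 f ≤ k}) := by
  set G : Set Ω := {f | ∑ j, (W j).indicator 1 f ≤ k}
  have h_int {E : Set Ω} (hE : MeasurableSet E) :
      MeasureTheory.Integrable (E.indicator (1 : Ω → ℝ)) μ :=
    (MeasureTheory.integrable_const (1 : ℝ)).indicator hE
  have hG : MeasurableSet G := measurableSet_sum_indicator_le hW k
  have h_pointwise (f : Ω) : ∑ j, (W j).indicator 1 f ≤
      k + Fintype.card ι * Gᶜ.indicator 1 f := by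
    by_cases hf : f ∈ G
    · simpa [hf] using hf.out
    · have h_card : ∑ j, (W j).indicator 1 f ≤ ∑ _j : ι, (1 : ℝ) :=
        Finset.sum_le_sum fun j _ => Set.indicator_le_self' (fun _ _ => zero_le_one) f
      simp only [Finset.sum_const, Finset.card_univ, nsmul_eq_mul, mul_one, Set.mem_compl_iff, hf,
        not_false_eq_true, Set.indicator_of_mem, Pi.one_apply] at h_card ⊢
      linarith
  calc ∑ j, μ.real (W j) = ∫ f, ∑ j, (W j).indicator 1 f ∂μ := by
        rw [MeasureTheory.integral_finsetSum _ fun j _ => h_int (hW j)]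
        exact Finset.sum_congr rfl fun j _ => (MeasureTheory.integral_indicator_one (hW j)).symm
    _ ≤ ∫ f, k + Fintype.card ι * Gᶜ.indicator 1 f ∂μ :=
        MeasureTheory.integral_mono (MeasureTheory.integrable_finsetSum _ fun j _ => h_int (hW j))
          ((MeasureTheory.integrable_const k).add ((h_int hG.compl).const_mul _)) h_pointwise
    _ = k + Fintype.card ι * (1 - μ.real G) := by
        rw [MeasureTheory.integral_add (MeasureTheory.integrable_const k)
          ((h_int hG.compl).const_mul _), MeasureTheory.integral_const_mul,
          MeasureTheory.integral_indicator_one hG.compl,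
          MeasureTheory.probReal_compl_eq_one_sub hG]
        simp

end Testing

section UniformSignals

open Finset BigOperators

variable {n : ℕ} {S : Fin n → Type u} [∀ i, Fintype (S i)]

open scoped Classical in
theorem marginal_eq_mean (P : JointDist S) (i : Fin n) (a : S i) (ω : Bool) :
    marginal P i a ω = mean P fun x => if x.1 i = a ∧ x.2 = ω then 1 else 0 := by
  cases ω <;> simp [marginal, mean, Fintype.sum_prod_type]

variable [∀ i, Nonempty (S i)]

/-- The joint distribution with uniform signals and `P(ω = 1 ∣ s) = q s`. -/
def regressionDist (q : (∀ i, S i) → unitInterval) : JointDist S :=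
  ⟨fun x => (Fintype.card (∀ i, S i) : ℝ)⁻¹ * if x.2 then (q x.1 : ℝ) else 1 - q x.1,
    fun x => mul_nonneg (by positivity) <| by
      split_ifs
      exacts [(q x.1).2.1, sub_nonneg.2 (q x.1).2.2],
    by simp only [Fintype.sum_prod_type, Fintype.sum_bool, if_true, Bool.false_eq_true, if_false,
        ← mul_add, add_sub_cancel, mul_one, sum_const, card_univ, nsmul_eq_mul]
       exact mul_inv_cancel₀ (Nat.cast_ne_zero.2 Fintype.card_ne_zero)⟩

theorem mean_regressionDist (q : (∀ i, S i) → unitInterval) (g : (∀ i, S i) × Bool → ℝ) :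
    mean (regressionDist q) g = 𝔼 s, (q s * g (s, true) + (1 - q s) * g (s, false)) := by
  simp only [mean, regressionDist, Fintype.sum_prod_type, Fintype.sum_bool, if_true,
    Bool.false_eq_true, if_false, Fintype.expect_eq_sum_div_card, div_eq_inv_mul, mul_sum, mul_add,
    mul_assoc]

theorem loss_regressionDist (q : (∀ i, S i) → unitInterval) (f : Aggregator n) :
    loss (regressionDist q) f = 𝔼 s, (q s * (1 - q s) : ℝ) +
      𝔼 s, (f (reports (regressionDist q) s) - q s : ℝ) ^ 2 := by
  refine (mean_regressionDist q _).trans ?_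
  rw [← expect_add_distrib]
  refine expect_congr rfl fun s _ => ?_
  simp only [eventValue, if_true, Bool.false_eq_true, if_false, sq_abs]
  ring

theorem sqDist_regressionDist (q : (∀ i, S i) → unitInterval) (f g : Aggregator n) :
    sqDist (regressionDist q) f g = 𝔼 s, (f (reports (regressionDist q) s) -
      g (reports (regressionDist q) s) : ℝ) ^ 2 := by
  refine (mean_regressionDist q _).trans <| expect_congr rfl fun s _ => ?_
  rw [sq_abs]; ring

theorem IsOptimal.eq_regression {q : (∀ i, S i) → unitInterval}
    (hq : Function.Injective (reports (regressionDist q))) {g : Aggregator n}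
    (hg : IsOptimal (regressionDist q) g) (s : ∀ i, S i) :
    g (reports (regressionDist q) s) = q s := by
  have h_zero : 𝔼 s, (g (reports (regressionDist q) s) - q s : ℝ) ^ 2 ≤ 0 := by
    simpa [loss_regressionDist, hq.extend_apply] using
      hg (Function.extend (reports (regressionDist q)) q 0)
  have h_all := (expect_eq_zero_iff_of_nonneg fun s _ => sq_nonneg _).1
    (h_zero.antisymm (expect_nonneg fun s _ => sq_nonneg _))
  exact Subtype.ext (sub_eq_zero.1 (pow_eq_zero_iff two_ne_zero |>.1 (h_all s (mem_univ s))))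

theorem IsEpsOptimal.expect_sq_le {q : (∀ i, S i) → unitInterval}
    (hq : Function.Injective (reports (regressionDist q))) {ε : ℝ} {f : Aggregator n}
    (hf : IsEpsOptimal (regressionDist q) ε f) :
    𝔼 s, (f (reports (regressionDist q) s) - q s : ℝ) ^ 2 ≤ ε := by
  obtain ⟨g, hg, h_le⟩ := hf
  rwa [sqDist_regressionDist, expect_congr rfl fun s _ => by rw [hg.eq_regression hq s]] at h_le

open scoped Classical in
theorem report_regressionDist (q : (∀ i, S i) → unitInterval) (i : Fin n) (a : S i) :
    (report (regressionDist q) i a : ℝ) = 𝔼 s with s i = a, (q s : ℝ) := by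
  have h_true : marginal (regressionDist q) i a true =
      (Fintype.card (∀ i, S i) : ℝ)⁻¹ * ∑ s with s i = a, (q s : ℝ) := by
    simp only [marginal, regressionDist, if_true, sum_filter, mul_sum, mul_ite, mul_zero]
  have h_false : marginal (regressionDist q) i a false =
      (Fintype.card (∀ i, S i) : ℝ)⁻¹ * ∑ s with s i = a, (1 - q s : ℝ) := by
    simp only [marginal, regressionDist, Bool.false_eq_true, if_false, sum_filter, mul_sum,
      mul_ite, mul_zero]
  rw [report, Subtype.coe_mk, h_true, h_false, ← mul_add, ← sum_add_distrib,
    mul_div_mul_left _ _ (inv_ne_zero (Nat.cast_ne_zero.2 Fintype.card_ne_zero)),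
    expect_eq_sum_div_card]
  simp

theorem affinity_regressionDist (q q' : (∀ i, S i) → unitInterval) :
    affinity (regressionDist q) (regressionDist q') =
      𝔼 s, (√(q s * q' s) + √((1 - q s) * (1 - q' s))) := by
  have h_scale (u v : ℝ) : √((Fintype.card (∀ i, S i) : ℝ)⁻¹ * u *
      ((Fintype.card (∀ i, S i) : ℝ)⁻¹ * v)) = (Fintype.card (∀ i, S i) : ℝ)⁻¹ * √(u * v) := by
    rw [mul_mul_mul_comm, Real.sqrt_mul (mul_self_nonneg _), Real.sqrt_mul_self (by positivity)]
  simp only [affinity, regressionDist, Fintype.sum_prod_type, Fintype.sum_bool, if_true,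
    Bool.false_eq_true, if_false, Fintype.expect_eq_sum_div_card, div_eq_inv_mul, mul_sum, h_scale,
    mul_add]

end UniformSignals

section LowerBound

open Finset BigOperators

theorem expect_ite_restrict_eq {ι : Type*} [Fintype ι] [DecidableEq ι] {S : ι → Type*}
    [∀ i, Fintype (S i)] [∀ i, Nonempty (S i)] (I : Finset ι) [DecidableEq (∀ i : I, S i)]
    (c : ∀ i : I, S i) :
    𝔼 s : ∀ i, S i, (if I.restrict s = c then 1 else 0 : ℝ) =
      (Fintype.card (∀ i : I, S i) : ℝ)⁻¹ :=
  calc 𝔼 s : ∀ i, S i, (if I.restrict s = c then 1 else 0 : ℝ)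
      = 𝔼 x : (∀ i : I, S i) × ∀ i : {i // i ∉ I}, S i, if x.1 = c then 1 else 0 :=
        Fintype.expect_equiv (Equiv.piEquivPiSubtypeProd (· ∈ I) S) _ _ fun _ => rfl
    _ = 𝔼 x : ∀ i : I, S i, 𝔼 _y : ∀ i : {i // i ∉ I}, S i, (if x = c then 1 else 0 : ℝ) := by
        rw [← univ_product_univ, expect_product]
    _ = (Fintype.card (∀ i : I, S i) : ℝ)⁻¹ := by
        simp only [Fintype.expect_const]
        rw [Fintype.expect_eq_sum_div_card, Fintype.sum_ite_eq', one_div]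

theorem sub_four_mul_sq_le_sqrt {b γ : ℝ} (hb : 1 / 4 ≤ b) (hγ : γ ∈ Set.Icc (0 : ℝ) (1 / 4)) :
    b - 4 * γ ^ 2 ≤ √((b + γ) * (b - γ)) := by
  have h_sq : γ ^ 2 ≤ (1 / 4) ^ 2 := pow_le_pow_left₀ hγ.1 hγ.2 2
  refine Real.le_sqrt_of_sq_le ?_
  nlinarith [mul_nonneg (sq_nonneg γ) (sub_nonneg.2 hb),
    mul_nonneg (sq_nonneg γ) (sub_nonneg.2 h_sq)]

theorem one_sub_le_sqrt_add_sqrt {b γ : ℝ} (hb : b ∈ Set.Icc (1 / 4 : ℝ) (3 / 4))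
    (hγ : γ ∈ Set.Icc (0 : ℝ) (1 / 4)) :
    1 - 8 * γ ^ 2 ≤ √((b + γ) * (b - γ)) + √((1 - (b + γ)) * (1 - (b - γ))) := by
  have h_true := sub_four_mul_sq_le_sqrt hb.1 hγ
  have h_false := sub_four_mul_sq_le_sqrt (b := 1 - b) (by linarith [hb.2]) hγ
  rw [← sub_sub, ← sub_add, mul_comm (1 - b - γ)]
  linarith

/-- The permutation of a product that permutes the coordinate `i` by `v`. -/
def permAt {ι : Type*} [DecidableEq ι] {S : ι → Type*} (i : ι) (v : Equiv.Perm (S i)) :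
    Equiv.Perm (∀ j, S j) :=
  Equiv.piCongrRight (Pi.mulSingle i v)

section permAt

variable {ι : Type*} [DecidableEq ι] {S : ι → Type*} {i j : ι} (v : Equiv.Perm (S i))
  (s : ∀ j, S j)

theorem permAt_apply_self : permAt i v s i = v (s i) := by
  simp [permAt]

theorem permAt_apply_of_ne (h : j ≠ i) : permAt i v s j = s j := by
  simp [permAt, Pi.mulSingle_eq_of_ne h]

end permAt

variable {n : ℕ} {S : Fin n → Type u}

/-- The data of the lower-bound construction: two experts with binary signals, whose parity masks
one hidden bit per joint signal of the other experts, and the size `γ` of the effect of that bit on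
the regression function. -/
structure HardFamily (S : Fin n → Type u) where
  i₀ : Fin n
  i₁ : Fin n
  ne : i₀ ≠ i₁
  e₀ : S i₀ ≃ Bool
  e₁ : S i₁ ≃ Bool
  γ : ℝ
  γ_mem : γ ∈ Set.Icc (0 : ℝ) (1 / 4)

namespace HardFamily

variable (H : HardFamily S)

/-- A joint signal of the experts other than `i₀` and `i₁`. -/
abbrev Cell : Type u := ∀ i : ({H.i₀, H.i₁}ᶜ : Finset (Fin n)), S i

/-- The cell containing the joint signal `s`. -/
def cell (s : ∀ i, S i) : H.Cell := restrict _ s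

/-- The hidden bit `τ (cell s)`, masked by the parity of the two binary signals. -/
def bit (τ : H.Cell → Bool) (s : ∀ i, S i) : Bool :=
  H.e₀ (s H.i₀) ^^ (H.e₁ (s H.i₁) ^^ τ (H.cell s))

theorem eight_mul_sq_le : 8 * H.γ ^ 2 ≤ 1 / 2 := by
  linarith [pow_le_pow_left₀ H.γ_mem.1 H.γ_mem.2 2]

theorem cell_permAt {i : Fin n} (hi : i ∉ ({H.i₀, H.i₁}ᶜ : Finset (Fin n)))
    (v : Equiv.Perm (S i)) (s : ∀ i, S i) : H.cell (permAt i v s) = H.cell s :=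
  funext fun j => permAt_apply_of_ne v s fun h => hi (h ▸ j.2)

theorem bit_ne_bit_iff {τ τ' : H.Cell → Bool} {s : ∀ i, S i} :
    H.bit τ s ≠ H.bit τ' s ↔ τ (H.cell s) ≠ τ' (H.cell s) := by
  simp [bit]

/-- Whichever expert `i` is, one of the two masking signals is not `i`'s own, and switching it flips
the parity; so no single signal says anything about the hidden bit. -/
theorem exists_bit_eq_not (i : Fin n) :
    ∃ φ : Equiv.Perm (∀ j, S j), ∀ s, φ s i = s i ∧ ∀ τ, H.bit τ (φ s) = !H.bit τ s := by
  by_cases hi : i = H.i₀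
  · exact ⟨permAt H.i₁ (H.e₁.symm.permCongr Equiv.boolNot), fun s =>
      ⟨permAt_apply_of_ne _ s (hi ▸ H.ne), fun τ => by
        simp [bit, H.cell_permAt, permAt_apply_self, permAt_apply_of_ne _ _ H.ne]⟩⟩
  · exact ⟨permAt H.i₀ (H.e₀.symm.permCongr Equiv.boolNot), fun s =>
      ⟨permAt_apply_of_ne _ s hi, fun τ => by
        simp [bit, H.cell_permAt, permAt_apply_self, permAt_apply_of_ne _ _ H.ne.symm]⟩⟩

end HardFamily

variable [∀ i, Fintype (S i)]

/-- A small shift of the regression function that reveals the signal `a` of expert `i`. -/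
def tilt (i : Fin n) (a : S i) : ℝ := Fintype.equivFin (S i) a / (8 * n * Fintype.card (S i))

theorem tilt_nonneg (i : Fin n) (a : S i) : 0 ≤ tilt i a := by
  rw [tilt]; positivity

theorem tilt_injective (i : Fin n) : Function.Injective (tilt (S := S) i) := by
  intro a b h
  have hn : (n : ℝ) ≠ 0 := Nat.cast_ne_zero.2 (Fin.pos i).ne'
  have hS : (Fintype.card (S i) : ℝ) ≠ 0 := Nat.cast_ne_zero.2 (Fintype.card_pos_iff.2 ⟨a⟩).ne'
  rw [tilt, tilt, div_left_inj' (by positivity)] at h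
  exact (Fintype.equivFin (S i)).injective (Fin.ext (Nat.cast_injective h))

theorem sum_tilt_le (s : ∀ i, S i) : ∑ i, tilt i (s i) ≤ 1 / 8 := by
  have h_le (i : Fin n) : tilt i (s i) ≤ 1 / (8 * n) := by
    have hS : (0 : ℝ) < Fintype.card (S i) := Nat.cast_pos.2 (Fintype.card_pos_iff.2 ⟨s i⟩)
    have hn : (0 : ℝ) < n := Nat.cast_pos.2 (Fin.pos i)
    rw [tilt, div_le_div_iff₀ (by positivity) (by positivity), one_mul, mul_comm]
    gcongr
    exact (Fintype.equivFin (S i) (s i)).is_lt.le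
  calc ∑ i, tilt i (s i) ≤ ∑ _i : Fin n, (1 / (8 * n) : ℝ) := sum_le_sum fun i _ => h_le i
    _ = n / n / 8 := by rw [sum_const, card_univ, Fintype.card_fin, nsmul_eq_mul]; ring
    _ ≤ 1 / 8 := by gcongr; exact div_self_le_one _

/-- The part of the regression function that does not depend on the hidden bits. -/
def base (s : ∀ i, S i) : ℝ := 1 / 2 + ∑ i, tilt i (s i)

theorem base_mem (s : ∀ i, S i) : base s ∈ Set.Icc (1 / 2 : ℝ) (5 / 8) := by
  have h_nonneg : 0 ≤ ∑ i, tilt i (s i) := sum_nonneg fun i _ => tilt_nonneg i (s i)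
  constructor <;> rw [base] <;> linarith [sum_tilt_le s]

theorem base_permAt {i : Fin n} (v : Equiv.Perm (S i)) (s : ∀ i, S i) :
    base (permAt i v s) = base s + (tilt i (v (s i)) - tilt i (s i)) := by
  have h_ne : ∑ j ∈ univ.erase i, tilt j (permAt i v s j) = ∑ j ∈ univ.erase i, tilt j (s j) :=
    sum_congr rfl fun j hj => by rw [permAt_apply_of_ne v s (ne_of_mem_erase hj)]
  rw [base, base, ← add_sum_erase _ _ (mem_univ i), ← add_sum_erase _ _ (mem_univ i), h_ne,
    permAt_apply_self]
  ring

/-- The signed effect `±1` of a bit. -/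
def boolSign (b : Bool) : ℝ := bif b then 1 else -1

theorem boolSign_not (b : Bool) : boolSign (!b) = -boolSign b := by
  cases b <;> simp [boolSign]

namespace HardFamily

variable (H : HardFamily S)

/-- The regression function hiding the bits `τ`. -/
def regression (τ : H.Cell → Bool) (s : ∀ i, S i) : unitInterval :=
  ⟨base s + H.γ * boolSign (H.bit τ s), by
    have := base_mem s
    have := H.γ_mem
    cases H.bit τ s <;> simp only [boolSign, cond_true, cond_false, Set.mem_Icc] at * <;>
      constructor <;> linarith⟩

open scoped Classical in
theorem expect_boolSign_bit (τ : H.Cell → Bool) (i : Fin n) (a : S i) :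
    𝔼 s with s i = a, boolSign (H.bit τ s) = 0 := by
  obtain ⟨φ, hφ⟩ := H.exists_bit_eq_not i
  have h_neg : 𝔼 s with s i = a, boolSign (H.bit τ s) =
      𝔼 s with s i = a, -boolSign (H.bit τ s) :=
    (expect_equiv φ (by simp [hφ]) fun s _ => by rw [(hφ s).2, boolSign_not]).symm
  rw [expect_neg_distrib] at h_neg
  linarith

variable [∀ i, Nonempty (S i)]

/-- The distribution hiding the bits `τ`. -/
def dist (τ : H.Cell → Bool) : JointDist S := regressionDist (H.regression τ)

open scoped Classical in
theorem report_dist (τ : H.Cell → Bool) (i : Fin n) (a : S i) :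
    (report (H.dist τ) i a : ℝ) = 𝔼 s with s i = a, base s := by
  rw [dist, report_regressionDist]
  simp only [regression, expect_add_distrib, ← mul_expect, expect_boolSign_bit, mul_zero,
    add_zero]

theorem reports_dist (τ τ' : H.Cell → Bool) : reports (H.dist τ) = reports (H.dist τ') := by
  ext s i
  rw [reports, reports, report_dist, report_dist]

theorem report_dist_sub (τ : H.Cell → Bool) (i : Fin n) (a b : S i) :
    (report (H.dist τ) i b - report (H.dist τ) i a : ℝ) = tilt i b - tilt i a := by
  classical
  have h_nonempty : (univ.filter fun s : ∀ j, S j => s i = a).Nonempty :=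
    ⟨Function.update (fun j => Classical.arbitrary (S j)) i a, by simp⟩
  have h_swap : 𝔼 s with s i = b, base s = 𝔼 s with s i = a, (base s + (tilt i b - tilt i a)) := by
    refine (expect_equiv (permAt i (Equiv.swap a b)) (fun s => ?_) fun s hs => ?_).symm
    · simp [permAt_apply_self, Equiv.swap_apply_eq_iff]
    · rw [base_permAt, (mem_filter.1 hs).2, Equiv.swap_apply_left]
  rw [report_dist, report_dist, h_swap, expect_add_distrib, expect_const h_nonempty,
    add_sub_cancel_left]

theorem reports_injective (τ : H.Cell → Bool) : Function.Injective (reports (H.dist τ)) := by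
  refine fun s s' h => funext fun i => tilt_injective i ?_
  have h_report : report (H.dist τ) i (s i) = report (H.dist τ) i (s' i) := congrFun h i
  have h_sub := H.report_dist_sub τ i (s i) (s' i)
  rw [h_report] at h_sub
  linarith

theorem le_affinity (τ τ' : H.Cell → Bool) :
    1 - 8 * H.γ ^ 2 * 𝔼 s, (if τ (H.cell s) ≠ τ' (H.cell s) then 1 else 0 : ℝ) ≤
      affinity (H.dist τ) (H.dist τ') := by
  rw [dist, dist, affinity_regressionDist, mul_expect,
    ← Fintype.expect_const (ι := ∀ i, S i) (1 : ℝ), ← expect_sub_distrib]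
  refine expect_le_expect fun s _ => ?_
  split_ifs with h
  · have h_not : H.bit τ' s = !H.bit τ s := (Bool.not_eq.2 (H.bit_ne_bit_iff.2 h)).symm
    have h_base : base s ∈ Set.Icc (1 / 4 : ℝ) (3 / 4) :=
      Set.Icc_subset_Icc (by norm_num) (by norm_num) (base_mem s)
    rw [Fintype.expect_const, mul_one]
    refine (one_sub_le_sqrt_add_sqrt h_base H.γ_mem).trans_eq ?_
    cases h_bit : H.bit τ s <;> simp only [regression, h_not, h_bit, boolSign, Bool.not_true,
      Bool.not_false, cond_true, cond_false] <;> ring_nf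
  · have h_eq : H.bit τ s = H.bit τ' s := of_not_not (mt H.bit_ne_bit_iff.1 h)
    have h_reg : H.regression τ s = H.regression τ' s := by simp only [regression, h_eq]
    rw [Fintype.expect_const, h_reg, Real.sqrt_mul_self (H.regression τ' s).2.1,
      Real.sqrt_mul_self (sub_nonneg.2 (H.regression τ' s).2.2), mul_zero, sub_zero, add_sub_cancel]

theorem one_sub_le_affinity (τ τ' : H.Cell → Bool) :
    1 - 8 * H.γ ^ 2 ≤ affinity (H.dist τ) (H.dist τ') := by
  have h_le : 𝔼 s, (if τ (H.cell s) ≠ τ' (H.cell s) then 1 else 0 : ℝ) ≤ 1 :=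
    expect_le univ_nonempty fun s _ => by split_ifs <;> norm_num
  have := H.le_affinity τ τ'
  have := mul_le_mul_of_nonneg_left h_le (sq_nonneg H.γ)
  linarith

theorem le_affinity_flipAt [DecidableEq H.Cell] (τ : H.Cell → Bool) (c : H.Cell) :
    1 - 8 * H.γ ^ 2 / Fintype.card H.Cell ≤ affinity (H.dist τ) (H.dist (flipAt c τ)) := by
  have h_flip (s : ∀ i, S i) : τ (H.cell s) ≠ flipAt c τ (H.cell s) ↔ restrict _ s = c := by
    rw [flipAt_apply, cell]
    split_ifs with h <;> simp [h]
  have h_le := H.le_affinity τ (flipAt c τ)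
  simp only [h_flip] at h_le
  rwa [expect_ite_restrict_eq] at h_le

/-- The aggregators whose value at the reports of `s` decodes to the wrong value of the bit at
`s`. -/
def wrong (τ : H.Cell → Bool) (s : ∀ i, S i) : Set (Aggregator n) :=
  {f | decide (base s ≤ f (reports (H.dist τ) s)) ≠ H.bit τ s}

theorem measurableSet_wrong (τ : H.Cell → Bool) (s : ∀ i, S i) : MeasurableSet (H.wrong τ s) := by
  have h_le : MeasurableSet {f : Aggregator n | base s ≤ (f (reports (H.dist τ) s) : ℝ)} :=
    measurableSet_le measurable_const (measurable_subtype_coe.comp (measurable_pi_apply _))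
  cases h : H.bit τ s
  · simpa [wrong, h] using h_le
  · simpa [wrong, h, Set.compl_ofPred] using h_le.compl

theorem wrong_eq_compl {τ τ' : H.Cell → Bool} {s : ∀ i, S i}
    (h : τ (H.cell s) ≠ τ' (H.cell s)) : H.wrong τ' s = (H.wrong τ s)ᶜ := by
  have h_not : H.bit τ s = !H.bit τ' s := Bool.eq_not.2 (H.bit_ne_bit_iff.2 h)
  ext f
  simp [wrong, H.reports_dist τ' τ, h_not]

theorem sq_le_of_mem_wrong {τ : H.Cell → Bool} {s : ∀ i, S i} {f : Aggregator n}
    (hf : f ∈ H.wrong τ s) :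
    H.γ ^ 2 ≤ (f (reports (H.dist τ) s) - H.regression τ s : ℝ) ^ 2 := by
  have hγ := H.γ_mem.1
  cases h : H.bit τ s <;>
    simp only [wrong, h, ne_eq, decide_eq_false_iff_not, decide_eq_true_eq, not_le,
      Set.mem_ofPred_eq] at hf <;>
    simp only [regression, boolSign, h, cond_false, cond_true] <;>
    nlinarith

/-- The aggregators that decode the wrong bit at no more than a sixteenth of the joint signals. -/
def mostlyRight (τ : H.Cell → Bool) : Set (Aggregator n) :=
  {f | ∑ s, (H.wrong τ s).indicator 1 f ≤ (Fintype.card (∀ i, S i) / 16 : ℝ)}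

theorem measurableSet_mostlyRight (τ : H.Cell → Bool) : MeasurableSet (H.mostlyRight τ) :=
  measurableSet_sum_indicator_le (H.measurableSet_wrong τ) _

theorem mem_mostlyRight {τ : H.Cell → Bool} {ε : ℝ} (hε : 0 < ε) (hγ : 16 * ε ≤ H.γ ^ 2)
    {f : Aggregator n} (hf : IsEpsOptimal (H.dist τ) ε f) : f ∈ H.mostlyRight τ := by
  have h_wrong (s : ∀ i, S i) : H.γ ^ 2 * (H.wrong τ s).indicator 1 f ≤
      (f (reports (H.dist τ) s) - H.regression τ s : ℝ) ^ 2 := by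
    by_cases h : f ∈ H.wrong τ s
    · simpa [h] using H.sq_le_of_mem_wrong h
    · simpa [h] using sq_nonneg _
  have h_le : 𝔼 s, (f (reports (H.dist τ) s) - H.regression τ s : ℝ) ^ 2 ≤ ε :=
    hf.expect_sq_le (H.reports_injective τ)
  rw [Fintype.expect_eq_sum_div_card, div_le_iff₀ (Nat.cast_pos.2 Fintype.card_pos)] at h_le
  have h_sum := (sum_le_sum fun s _ => h_wrong s).trans h_le
  rw [← mul_sum] at h_sum
  refine le_of_mul_le_mul_left (h_sum.trans ?_) (hε.trans_le (by linarith) : 0 < H.γ ^ 2)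
  nlinarith [(Nat.cast_nonneg (Fintype.card (∀ i, S i)) : (0 : ℝ) ≤ _)]

theorem disjoint_mostlyRight {τ τ' : H.Cell → Bool} (h : ∀ c, τ c ≠ τ' c) :
    Disjoint (H.mostlyRight τ) (H.mostlyRight τ') := by
  refine Set.disjoint_left.2 fun f hf hf' => ?_
  have h_add (s : ∀ i, S i) : (H.wrong τ s).indicator (1 : Aggregator n → ℝ) f +
      (H.wrong τ' s).indicator 1 f = 1 := by
    rw [H.wrong_eq_compl (h _), Set.indicator_self_add_compl_apply, Pi.one_apply]
  have h_sum := add_le_add hf.out hf'.out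
  simp only [← sum_add_distrib, h_add, sum_const, card_univ, nsmul_eq_mul, mul_one] at h_sum
  have h_pos : (0 : ℝ) < Fintype.card (∀ i, S i) := Nat.cast_pos.2 Fintype.card_pos
  linarith

/-- The law of the output of the learner `A` on the samples `x` from the distribution hiding the
bits `τ`. -/
def outputLaw {T : ℕ} (A : Learner n T) (τ : H.Cell → Bool) (x : Fin T → (∀ i, S i) × Bool) :
    MeasureTheory.Measure (Aggregator n) :=
  A fun t => (reports (H.dist τ) (x t).1, (x t).2)

variable {ε δ : ℝ} {T : ℕ} {A : Learner n T}

instance (τ : H.Cell → Bool) (x : Fin T → (∀ i, S i) × Bool) :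
    MeasureTheory.IsProbabilityMeasure (H.outputLaw A τ x) :=
  (A fun t => (reports (H.dist τ) (x t).1, (x t).2)).2

theorem outputLaw_eq (τ τ' : H.Cell → Bool) : H.outputLaw A τ = H.outputLaw A τ' := by
  funext x
  rw [outputLaw, outputLaw, H.reports_dist τ τ']

theorem le_mean_mostlyRight {τ : H.Cell → Bool} (hε : 0 < ε) (hγ : 16 * ε ≤ H.γ ^ 2)
    (hA : 1 - δ ≤ successProb (H.dist τ) ε A) :
    1 - δ ≤ mean (iid (H.dist τ) T) fun x => (H.outputLaw A τ x).real (H.mostlyRight τ) := by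
  refine hA.trans <| mean_mono (iid (H.dist τ) T) fun x => ?_
  exact MeasureTheory.measureReal_mono (μ := H.outputLaw A τ x)
    fun f hf => H.mem_mostlyRight hε hγ hf

theorem sum_mean_wrong_le {τ : H.Cell → Bool} (hε : 0 < ε) (hγ : 16 * ε ≤ H.γ ^ 2)
    (hA : 1 - δ ≤ successProb (H.dist τ) ε A) :
    ∑ s, mean (iid (H.dist τ) T) (fun x => (H.outputLaw A τ x).real (H.wrong τ s)) ≤
      Fintype.card (∀ i, S i) * (1 / 16 + δ) := by
  let K : ℝ := Fintype.card (∀ i, S i)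
  have hK : 0 ≤ K := Nat.cast_nonneg _
  let right (x : Fin T → (∀ i, S i) × Bool) : ℝ := (H.outputLaw A τ x).real (H.mostlyRight τ)
  have h_right : 1 - δ ≤ mean (iid (H.dist τ) T) right := H.le_mean_mostlyRight hε hγ hA
  calc ∑ s, mean (iid (H.dist τ) T) (fun x => (H.outputLaw A τ x).real (H.wrong τ s))
      = mean (iid (H.dist τ) T) fun x => ∑ s, (H.outputLaw A τ x).real (H.wrong τ s) :=
        (mean_sum _ _ _).symm
    _ ≤ mean (iid (H.dist τ) T) fun x => K * (1 / 16 + 1) - K * right x :=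
        mean_mono _ fun x => by
          have h := sum_measureReal_le (H.outputLaw A τ x) (k := K / 16)
            (H.measurableSet_wrong τ) (by positivity)
          exact h.trans_eq (by ring!)
    _ = K * (1 / 16 + 1) - K * mean (iid (H.dist τ) T) right := by
        rw [mean_sub, mean_const, mean_const_mul]
    _ ≤ K * (1 / 16 + δ) := by
        linarith [mul_le_mul_of_nonneg_left h_right hK]

theorem card_cell_le (hε : 0 < ε) (hγ : 16 * ε ≤ H.γ ^ 2) (hδ : δ ≤ 1 / 100)
    (hA : ∀ τ, 1 - δ ≤ successProb (H.dist τ) ε A) :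
    Fintype.card H.Cell ≤ 32 * T * H.γ ^ 2 := by
  classical
  let err (τ : H.Cell → Bool) (s : ∀ i, S i) (x : Fin T → (∀ i, S i) × Bool) : ℝ :=
    (H.outputLaw A τ x).real (H.wrong τ s)
  have h_flip (τ : H.Cell → Bool) (s : ∀ i, S i) (x : Fin T → (∀ i, S i) × Bool) :
      err (flipAt (H.cell s) τ) s x = 1 - err τ s x := by
    simp only [err]
    rw [H.outputLaw_eq _ τ, H.wrong_eq_compl (τ := τ) (by simp [flipAt_apply]),
      MeasureTheory.probReal_compl_eq_one_sub (H.measurableSet_wrong τ s)]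
  have h_aff (τ : H.Cell → Bool) (c : H.Cell) :
      1 - 2 * T * (8 * H.γ ^ 2 / Fintype.card H.Cell) ≤
        affinity (iid (H.dist τ) T) (iid (H.dist (flipAt c τ)) T) ^ 2 := by
    refine one_sub_le_affinity_iid_sq _ _ ?_ (H.le_affinity_flipAt τ c) T
    have h_one : (1 : ℝ) ≤ Fintype.card H.Cell := Nat.one_le_cast.2 (Fintype.card_pos_iff.2 ⟨c⟩)
    rw [div_le_one (by linarith)]
    linarith [H.eight_mul_sq_le]
  have h_card := assouad H.cell (fun τ => iid (H.dist τ) T) (err := err)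
    (fun τ s x => ⟨MeasureTheory.measureReal_nonneg, MeasureTheory.measureReal_le_one⟩) h_flip h_aff
    fun τ => H.sum_mean_wrong_le hε hγ (hA τ)
  rw [mul_left_comm] at h_card
  have h_le := le_of_mul_le_mul_left h_card (Nat.cast_pos.2 Fintype.card_pos)
  have h_half : 1 / 2 ≤ 16 * T * H.γ ^ 2 / Fintype.card H.Cell := by
    calc (1 / 2 : ℝ) ≤ 2 * T * (8 * H.γ ^ 2 / Fintype.card H.Cell) := by linarith
      _ = 16 * T * H.γ ^ 2 / Fintype.card H.Cell := by ring
  have h_cell : (0 : ℝ) < Fintype.card H.Cell := Nat.cast_pos.2 Fintype.card_pos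
  rw [le_div_iff₀ h_cell] at h_half
  linarith

theorem log_one_div_le (hε : 0 < ε) (hγ : 16 * ε ≤ H.γ ^ 2) (hδ : 0 < δ) (hδ1 : δ ≤ 1 / 100)
    (hA : ∀ τ, 1 - δ ≤ successProb (H.dist τ) ε A) :
    Real.log (1 / δ) ≤ 64 * T * H.γ ^ 2 := by
  let p (b : Bool) : stdSimplex ℝ (Fin T → (∀ i, S i) × Bool) := iid (H.dist fun _ => b) T
  let right (b : Bool) (x : Fin T → (∀ i, S i) × Bool) : ℝ :=
    (H.outputLaw A (fun _ => true) x).real (H.mostlyRight fun _ => b)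
  have h_true : 1 - δ ≤ mean (p true) (right true) := H.le_mean_mostlyRight hε hγ (hA _)
  have h_false : 1 - δ ≤ mean (p false) (right false) := by
    simpa only [H.outputLaw_eq (fun _ => false) fun _ => true] using
      H.le_mean_mostlyRight hε hγ (hA fun _ => false)
  have h_disjoint (x : Fin T → (∀ i, S i) × Bool) : right true x ≤ 1 - right false x := by
    rw [← MeasureTheory.probReal_compl_eq_one_sub (H.measurableSet_mostlyRight _)]
    exact MeasureTheory.measureReal_mono (H.disjoint_mostlyRight (by simp)).subset_compl_right
  have h_aff : affinity (p false) (p true) ^ 2 ≤ 4 * δ :=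
    calc affinity (p false) (p true) ^ 2
        ≤ 2 * (mean (p false) (right true) + mean (p true) fun x => 1 - right true x) :=
          affinity_sq_le_mean_add_mean _ _ fun x =>
            ⟨MeasureTheory.measureReal_nonneg, MeasureTheory.measureReal_le_one⟩
      _ ≤ 2 * (mean (p false) (fun x => 1 - right false x) +
            mean (p true) fun x => 1 - right true x) := by
          gcongr; exact mean_mono _ h_disjoint
      _ ≤ 4 * δ := by
          rw [mean_sub, mean_sub, mean_const, mean_const]; linarith
  have h_exp : Real.exp (-(4 * T * (8 * H.γ ^ 2))) ≤ 4 * δ :=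
    (exp_le_affinity_iid_sq _ _ ⟨by positivity, H.eight_mul_sq_le⟩
      (H.one_sub_le_affinity _ _) T).trans h_aff
  have h_exp_sq : Real.exp (-(64 * T * H.γ ^ 2)) ≤ δ :=
    calc Real.exp (-(64 * T * H.γ ^ 2)) = Real.exp (-(4 * T * (8 * H.γ ^ 2))) ^ 2 := by
          rw [← Real.exp_nat_mul]; push_cast; ring_nf
      _ ≤ (4 * δ) ^ 2 := by gcongr
      _ ≤ δ := by nlinarith
  rw [one_div, Real.log_inv, neg_le]
  exact (Real.le_log_iff_exp_le hδ).2 h_exp_sq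

end HardFamily

end LowerBound

theorem Suffices.prod_add_log_le_of_card_eq_two {n : ℕ} {S : Fin n → Type u}
    [∀ i, Fintype (S i)] [∀ i, Nonempty (S i)] {i₀ i₁ : Fin n} (h_ne : i₀ ≠ i₁)
    (h₀ : Fintype.card (S i₀) = 2) (h₁ : Fintype.card (S i₁) = 2) {ε δ : ℝ} (hε : 0 < ε)
    (hε1 : ε ≤ 1 / 256) (hδ : 0 < δ) (hδ1 : δ ≤ 1 / 100) {T : ℕ}
    (hT : Suffices (Set.univ : Set (JointDist S)) ε δ T) :
    ∏ i ∈ {i₀, i₁}ᶜ, (Fintype.card (S i) : ℝ) + Real.log (1 / δ) ≤ 1536 * ε * T := by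
  obtain ⟨A, hA⟩ := hT
  let H : HardFamily S :=
    { i₀ := i₀
      i₁ := i₁
      ne := h_ne
      e₀ := Fintype.equivOfCardEq (by simpa using h₀)
      e₁ := Fintype.equivOfCardEq (by simpa using h₁)
      γ := √(16 * ε)
      γ_mem := ⟨Real.sqrt_nonneg _, Real.sqrt_le_iff.2 ⟨by norm_num, by linarith⟩⟩ }
  have hγ : H.γ ^ 2 = 16 * ε := Real.sq_sqrt (by positivity)
  have h_card : ∏ i ∈ {i₀, i₁}ᶜ, (Fintype.card (S i) : ℝ) ≤ 32 * T * H.γ ^ 2 := by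
    have h := H.card_cell_le hε hγ.ge hδ1 fun τ => hA (H.dist τ) (Set.mem_univ _)
    rwa [Fintype.card_pi, Nat.cast_prod,
      Finset.prod_coe_sort ({i₀, i₁}ᶜ : Finset (Fin n)) fun i => (Fintype.card (S i) : ℝ)] at h
  have h_log : Real.log (1 / δ) ≤ 64 * T * H.γ ^ 2 :=
    H.log_one_div_le hε hγ.ge hδ hδ1 fun τ => hA (H.dist τ) (Set.mem_univ _)
  rw [hγ] at h_card h_log
  linarith

section Relabel

variable {n : ℕ} {R S : Fin n → Type u} [∀ i, Fintype (R i)] [∀ i, Fintype (S i)]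
  (e : ∀ i, R i ↪ S i) (P : JointDist R)

/-- The distribution `P` with every signal `r` of expert `i` renamed to `e i r`. -/
def relabel : JointDist S := stdSimplex.map (Prod.map (fun r i => e i (r i)) id) P

theorem report_relabel (i : Fin n) (a : R i) : report (relabel e P) i (e i a) = report P i a := by
  have h_marginal (ω : Bool) : marginal (relabel e P) i (e i a) ω = marginal P i a ω := by
    rw [marginal_eq_mean, marginal_eq_mean, relabel, mean_map]
    refine congrArg (mean P) (funext fun x => ?_)
    split_ifs <;> simp_all
  simp only [report, h_marginal]

theorem reports_relabel (r : ∀ i, R i) :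
    reports (relabel e P) (fun i => e i (r i)) = reports P r :=
  funext fun i => report_relabel e P i (r i)

theorem loss_relabel (f : Aggregator n) : loss (relabel e P) f = loss P f := by
  refine (mean_map _ P _).trans <| Finset.sum_congr rfl fun x _ => ?_
  simp [reports_relabel]

theorem sqDist_relabel (f g : Aggregator n) : sqDist (relabel e P) f g = sqDist P f g := by
  refine (mean_map _ P _).trans <| Finset.sum_congr rfl fun x _ => ?_
  simp [reports_relabel]

theorem isEpsOptimal_relabel {ε : ℝ} {f : Aggregator n} :
    IsEpsOptimal (relabel e P) ε f ↔ IsEpsOptimal P ε f := by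
  simp only [IsEpsOptimal, IsOptimal, loss_relabel, sqDist_relabel]

theorem successProb_relabel (ε : ℝ) {T : ℕ} (A : Learner n T) :
    successProb (relabel e P) ε A = successProb P ε A := by
  let success (y : Fin T → (∀ i, S i) × Bool) : ℝ :=
    (A fun t => (reports (relabel e P) (y t).1, (y t).2) : MeasureTheory.Measure _).real
      {f | IsEpsOptimal (relabel e P) ε f}
  calc successProb (relabel e P) ε A
      = mean (iid (relabel e P) T) success := rfl
    _ = mean (iid P T) (success ∘ (Prod.map (fun r i => e i (r i)) id ∘ ·)) := by
        rw [relabel, iid_map, mean_map]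
    _ = successProb P ε A := Finset.sum_congr rfl fun x _ => by
        simp only [success, iid, Function.comp_apply, Prod.map, reports_relabel,
          isEpsOptimal_relabel, id]

end Relabel

theorem Suffices.of_embedding {n : ℕ} {R S : Fin n → Type u} [∀ i, Fintype (R i)]
    [∀ i, Fintype (S i)] (e : ∀ i, R i ↪ S i) {ε δ : ℝ} {T : ℕ}
    (h : Suffices (Set.univ : Set (JointDist S)) ε δ T) :
    Suffices (Set.univ : Set (JointDist R)) ε δ T := by
  obtain ⟨A, hA⟩ := h
  exact ⟨A, fun P _ => successProb_relabel e P ε A ▸ hA (relabel e P) (Set.mem_univ _)⟩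

theorem Suffices.prod_add_log_le {n : ℕ} {S : Fin n → Type u} [∀ i, Fintype (S i)]
    [∀ i, Nonempty (S i)] {i₀ i₁ : Fin n} (h_ne : i₀ ≠ i₁) (h₀ : 2 ≤ Fintype.card (S i₀))
    (h₁ : 2 ≤ Fintype.card (S i₁)) {ε δ : ℝ} (hε : 0 < ε) (hε1 : ε ≤ 1 / 256) (hδ : 0 < δ)
    (hδ1 : δ ≤ 1 / 100) {T : ℕ} (hT : Suffices (Set.univ : Set (JointDist S)) ε δ T) :
    ∏ i ∈ {i₀, i₁}ᶜ, (Fintype.card (S i) : ℝ) + Real.log (1 / δ) ≤ 1536 * ε * T := by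
  classical
  have h_pair {i : Fin n} (hi : i ∈ ({i₀, i₁} : Finset (Fin n))) : 2 ≤ Fintype.card (S i) := by
    obtain rfl | rfl := Finset.mem_insert.1 hi |>.imp_right Finset.mem_singleton.1 <;> assumption
  have h_exists (i : Fin n) : ∃ R : Finset (S i), R.Nonempty ∧
      if i ∈ ({i₀, i₁} : Finset (Fin n)) then R.card = 2 else R = Finset.univ := by
    split_ifs with hi
    · obtain ⟨R, -, hR⟩ := Finset.exists_subset_card_eq (s := Finset.univ) (h_pair hi)
      exact ⟨R, Finset.card_pos.1 (hR ▸ two_pos), hR⟩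
    · exact ⟨Finset.univ, Finset.univ_nonempty, rfl⟩
  choose R hR_nonempty hR using h_exists
  have (i : Fin n) : Nonempty (R i) := (hR_nonempty i).to_subtype
  have h_two {i : Fin n} (hi : i ∈ ({i₀, i₁} : Finset (Fin n))) : Fintype.card (R i) = 2 := by
    simpa [hi] using hR i
  have h_prod : ∏ i ∈ {i₀, i₁}ᶜ, (Fintype.card (R i) : ℝ) =
      ∏ i ∈ {i₀, i₁}ᶜ, (Fintype.card (S i) : ℝ) := by
    refine Finset.prod_congr rfl fun i hi => ?_
    have hRi := hR i
    rw [if_neg (Finset.mem_compl.1 hi)] at hRi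
    rw [Fintype.card_coe, hRi, Finset.card_univ]
  rw [← h_prod]
  have hT' := hT.of_embedding fun i => Function.Embedding.subtype (· ∈ R i)
  exact hT'.prod_add_log_le_of_card_eq_two h_ne (h_two (by simp)) (h_two (by simp)) hε hε1 hδ hδ1

theorem le_sampleComplexity {n : ℕ} {S : Fin n → Type u} [∀ i, Fintype (S i)]
    {F : Set (JointDist S)} {ε δ B : ℝ} (hB : ∀ T, Suffices F ε δ T → B ≤ T) :
    ENNReal.ofReal B ≤ ((sampleComplexity F ε δ : ℕ∞) : ℝ≥0∞) := by
  rw [sampleComplexity]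
  obtain h | h := Set.eq_empty_or_nonempty {T₀ : ℕ | ∀ T : ℕ, T₀ ≤ T → Suffices F ε δ T}
  · simp [h]
  · obtain ⟨T₀, hT₀, hs⟩ := csInf_mem (h.image fun T₀ : ℕ => (T₀ : ℕ∞))
    rw [← hs]
    simpa using ENNReal.ofReal_le_ofReal (hB T₀ (hT₀ T₀ le_rfl))

end

end ForecastAggregation

open ForecastAggregation in
theorem theorem4p1_general :
    ∃ C c ε₀ : ℝ, 0 < C ∧ 0 < c ∧ 0 < ε₀ ∧
      ∀ (n : ℕ) (S : Fin n → Type u) [∀ i, Fintype (S i)] [∀ i, Nonempty (S i)] (ε δ : ℝ),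
        0 < ε → ε < 1 → 0 < δ → δ < 1 →
          (∀ F : Set (JointDist S), ((sampleComplexity F ε δ : ℕ∞) : ℝ≥0∞) ≤
            ENNReal.ofReal (C * ((∏ i, (Fintype.card (S i) : ℝ) + Real.log (1 / δ)) / ε ^ 2))) ∧
          ∀ i₀ i₁, i₀ ≠ i₁ → 2 ≤ Fintype.card (S i₀) → 2 ≤ Fintype.card (S i₁) →
            ε < ε₀ → δ < 1 / 100 →
              ENNReal.ofReal
                  (c * ((∏ i ∈ {i₀, i₁}ᶜ, (Fintype.card (S i) : ℝ) + Real.log (1 / δ)) / ε)) ≤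
                ((sampleComplexity (Set.univ : Set (JointDist S)) ε δ : ℕ∞) : ℝ≥0∞) := by
  refine ⟨17, 1 / 1536, 1 / 256, by norm_num, by norm_num, by norm_num, ?_⟩
  intro n S _ _ ε δ hε hε1 hδ hδ1
  refine ⟨fun F => sampleComplexity_le F hε hε1.le hδ hδ1.le, ?_⟩
  intro i₀ i₁ h_ne h₀ h₁ hε₀ hδ₀
  refine le_sampleComplexity fun T hT => ?_
  have h := hT.prod_add_log_le h_ne h₀ h₁ hε hε₀.le hδ hδ₀.le
  rw [one_div_mul_eq_div, div_div, div_le_iff₀ (by positivity)]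
  linarith

theorem theorem4p1 :
    ∃ C c ε₀ : ℝ, 0 < C ∧ 0 < c ∧ 0 < ε₀ ∧
      ∀ (n m : ℕ) (S : Fin n → Type u) [∀ i, Fintype (S i)],
        2 ≤ n → 1 ≤ m → (∀ i, Fintype.card (S i) = m) →
        ∀ ε δ : ℝ, 0 < ε → ε < 1 → 0 < δ → δ < 1 →
          ((ForecastAggregation.sampleComplexity
              (Set.univ : Set (ForecastAggregation.JointDist S)) ε δ : ℕ∞) : ℝ≥0∞) ≤
            ENNReal.ofReal (C * (((m : ℝ) ^ n + Real.log (1 / δ)) / ε ^ 2)) ∧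
          (2 ≤ m → ε < ε₀ → δ < 1 / 100 →
            ENNReal.ofReal (c * (((m : ℝ) ^ (n - 2) + Real.log (1 / δ)) / ε)) ≤
              ((ForecastAggregation.sampleComplexity
                (Set.univ : Set (ForecastAggregation.JointDist S)) ε δ : ℕ∞) : ℝ≥0∞)) := by
  obtain ⟨C, c, ε₀, hC, hc, hε₀, h⟩ := theorem4p1_general.{u}
  refine ⟨C, c, ε₀, hC, hc, hε₀, fun n m S _ hn hm h_card ε δ hε hε1 hδ hδ1 => ?_⟩
  have (i : Fin n) : Nonempty (S i) := Fintype.card_pos_iff.1 (h_card i ▸ hm)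
  obtain ⟨h_upper, h_lower⟩ := h n S ε δ hε hε1 hδ hδ1
  simp only [h_card, Finset.prod_const] at h_upper h_lower
  refine ⟨by simpa using h_upper Set.univ, fun hm2 hε2 hδ2 => ?_⟩
  have h_two := h_lower ⟨0, by lia⟩ ⟨1, by lia⟩ (by simp) hm2 hm2 hε2 hδ2
  rwa [Finset.card_compl, Finset.card_pair (by simp), Fintype.card_fin] at h_two
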